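/- Let $\mathcal{A},\mathcal{B}$ be nonempty finite sets, let $\Delta(\mathcal{A}),\Delta(\mathcal{B})$ be the sets of probability vectors over them, let $d\geq 0$, let $\mathbf{B}$ denote the closed Euclidean unit ball of $\mathbb{R}^d$, and let $\overline{m}$ be a function that assigns to each $(\mathbf{x},\mathbf{y})\in\Delta(\mathcal{A})\times\Delta(\mathcal{B})$ a subset $\overline{m}(\mathbf{x},\mathbf{y})$ of $\mathbb{R}^d$. Sums and scalar multiples of sets are taken in the sense of Minkowski. We say that $\overline{m}$ is - *bounded* if there is $M\in\mathbb{R}$ with $\|v\|_2\leq M$ for all $\mathbf{x},\mathbf{y}$ and all $v\in\overline{m}(\mathbf{x},\mathbf{y})$; - *uniformly continuous in its first argument* if for all $\varepsilon>0$ there is $\eta>0$ such that $\overline{m}(\mathbf{x}',\mathbf{y})\subseteq\overline{m}(\mathbf{x},\mathbf{y})+\varepsilon\mathbf{B}$ for all $\mathbf{x},\mathbf{x}'\in\Delta(\mathcal{A})$ with $\|\mathbf{x}-\mathbf{x}'\|_1\leq\eta$ and all $\mathbf{y}\in\Delta(\mathcal{B})$; uniform continuity in the second argument is defined symmetrically;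 - *concave in its first argument* if $\overline{m}(\alpha\mathbf{x}+(1-\alpha)\mathbf{x}',\mathbf{y})\subseteq\alpha\,\overline{m}(\mathbf{x},\mathbf{y})+(1-\alpha)\,\overline{m}(\mathbf{x}',\mathbf{y})$ for all $\mathbf{x},\mathbf{x}'\in\Delta(\mathcal{A})$, $\mathbf{y}\in\Delta(\mathcal{B})$, $\alpha\in[0,1]$; - *convex in its second argument* if $\alpha\,\overline{m}(\mathbf{x},\mathbf{y})+(1-\alpha)\,\overline{m}(\mathbf{x},\mathbf{y}')\subseteq\overline{m}(\mathbf{x},\alpha\mathbf{y}+(1-\alpha)\mathbf{y}')$ for all $\mathbf{x}\in\Delta(\mathcal{A})$, $\mathbf{y},\mathbf{y}'\in\Delta(\mathcal{B})$, $\alpha\in[0,1]$. In the repeated game, at each round $t=1,2,\ldots$ the two players simultaneously choose mixed actions $\mathbf{x}_t\in\Delta(\mathcal{A})$ and $\mathbf{y}_t\in\Delta(\mathcal{B})$, and both are observed at the end of the round. A strategy of a player prescribes, measurably in the past actions $(\mathbf{x}_s,\mathbf{y}_s)_{s<t}$, a probability distribution from which his action of round $t$ is drawn, independently of the opponent's draw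 given the past. A set $\mathcal{C}\subseteq\mathbb{R}^d$ is *$\overline{m}$-robust approachable with mixed actions* if there is a strategy of the first player such that for all $\varepsilon>0$ there is an integer $T_\varepsilon\geq 1$ such that for all strategies of the second player $$\mathbb{P}\Bigl\{\forall\,T\geq T_\varepsilon,\quad \sup_{v\in\frac1T\sum_{t=1}^T\overline{m}(\mathbf{x}_t,\mathbf{y}_t)}\ \inf_{c\in\mathcal{C}}\ \|c-v\|_2\leq\varepsilon\Bigr\}\geq 1-\varepsilon$$ (if the event is not measurable, this means that it contains a measurable event of probability at least $1-\varepsilon$; the supremum is taken in $[0,+\infty]$, with $\inf\emptyset=+\infty$ and $\sup\emptyset=0$). The *robust approachability condition* for $\overline{m}$ and $\mathcal{C}$ is $$\text{(RAC)}\qquad \forall\,\mathbf{y}\in\Delta(\mathcal{B})\ \ \exists\,\mathbf{x}\in\Delta(\mathcal{A}):\quad \overline{m}(\mathbf{x},\mathbf{y})\subseteq\mathcal{C}.$$ **Theorem.** Let $\mathcal{C}\subseteq\mathbb{R}^d$ be closed and convex. 1. If $\overline{m}$ is bounded, and convex and uniformly continuous in its second argument, then (RAC) implies that $\mathcal{C}$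 is $\overline{m}$-robust approachable with mixed actions. 2. If $\overline{m}$ is concave and uniformly continuous in its first argument, and if $\mathcal{C}$ is $\overline{m}$-robust approachable with mixed actions, then (RAC) holds. -/

import Mathlib

open scoped Pointwise ENNReal

/-- The reward space `ℝ^d` with its Euclidean norm. -/
abbrev Reward (d : ℕ) : Type := EuclideanSpace ℝ (Fin d)

/-- The set `Δ(A)` of mixed actions (probability vectors) over a finite action set `A`. -/
abbrev Mixed (A : Type*) [Fintype A] : Type _ := stdSimplex ℝ A

/-- The `ℓ¹` distance between two mixed actions. -/
def l1dist {A : Type*} [Fintype A] (x x' : Mixed A) : ℝ := ∑ a, |x.1 a - x'.1 a|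

section SetValued

variable {A B : Type*} [Fintype A] [Fintype B] {d : ℕ}

/-- The set-valued function `m` is bounded in Euclidean norm. -/
def BoundedPayoff (m : Mixed A → Mixed B → Set (Reward d)) : Prop :=
  ∃ M : ℝ, ∀ x y, ∀ v ∈ m x y, ‖v‖ ≤ M

/-- Uniform continuity in the first argument, uniformly over the second one. -/
def UnifContFst (m : Mixed A → Mixed B → Set (Reward d)) : Prop :=
  ∀ ε : ℝ, 0 < ε → ∃ η : ℝ, 0 < η ∧ ∀ x x' : Mixed A, l1dist x x' ≤ η →
    ∀ y : Mixed B, m x' y ⊆ m x y + Metric.closedBall (0 : Reward d) ε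

/-- Uniform continuity in the second argument, uniformly over the first one. -/
def UnifContSnd (m : Mixed A → Mixed B → Set (Reward d)) : Prop :=
  ∀ ε : ℝ, 0 < ε → ∃ η : ℝ, 0 < η ∧ ∀ y y' : Mixed B, l1dist y y' ≤ η →
    ∀ x : Mixed A, m x y' ⊆ m x y + Metric.closedBall (0 : Reward d) ε

/-- Concavity in the first argument:
`m (α x + (1 - α) x', y) ⊆ α m (x, y) + (1 - α) m (x', y)`. -/
def ConcaveFst (m : Mixed A → Mixed B → Set (Reward d)) : Prop :=
  ∀ x x' z : Mixed A, ∀ y : Mixed B, ∀ α : ℝ, 0 ≤ α → α ≤ 1 →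
    z.1 = α • x.1 + (1 - α) • x'.1 → m z y ⊆ α • m x y + (1 - α) • m x' y

/-- Convexity in the second argument:
`α m (x, y) + (1 - α) m (x, y') ⊆ m (x, α y + (1 - α) y')`. -/
def ConvexSnd (m : Mixed A → Mixed B → Set (Reward d)) : Prop :=
  ∀ x : Mixed A, ∀ y y' z : Mixed B, ∀ α : ℝ, 0 ≤ α → α ≤ 1 →
    z.1 = α • y.1 + (1 - α) • y'.1 → α • m x y + (1 - α) • m x y' ⊆ m x z

/-- The robust approachability condition. -/
def RAC (m : Mixed A → Mixed B → Set (Reward d)) (C : Set (Reward d)) : Prop :=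
  ∀ y : Mixed B, ∃ x : Mixed A, m x y ⊆ C

end SetValued

section Game

open MeasureTheory ProbabilityTheory

/-- A (possibly randomized) strategy of a player whose moves lie in `S`, in a repeated game
where an outcome in `H` is observed at the end of each round. Rounds are numbered from `0`.
The move of round `0` is drawn from `init`, and the move of round `n + 1` from `next n`, given
the outcomes of the rounds `0, …, n`. -/
structure Strategy (H S : Type*) [MeasurableSpace H] [MeasurableSpace S] where
  init : Measure S
  next : (n : ℕ) → Kernel ((i : Finset.Iic n) → H) S
  init_prob : IsProbabilityMeasure init
  next_markov : ∀ n, IsMarkovKernel (next n)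

attribute [instance] Strategy.init_prob Strategy.next_markov

variable {A B : Type*} [Fintype A] [Fintype B] {d : ℕ}

/-- Strategies of the first player; both mixed actions are observed after each round. -/
abbrev Strategy₁ (A B : Type*) [Fintype A] [Fintype B] : Type _ :=
  Strategy (Mixed A × Mixed B) (Mixed A)

/-- Strategies of the second player. -/
abbrev Strategy₂ (A B : Type*) [Fintype A] [Fintype B] : Type _ :=
  Strategy (Mixed A × Mixed B) (Mixed B)

/-- The law of the infinite play `(x_t, y_t)_{t ≥ 0}`: at each round the two players draw their
mixed actions simultaneously, i.e. independently given the past. -/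
noncomputable def playLaw (σ : Strategy₁ A B) (τ : Strategy₂ A B) :
    Measure (ℕ → Mixed A × Mixed B) :=
  Kernel.trajMeasure (X := fun _ => Mixed A × Mixed B)
    (σ.init.prod τ.init) (fun n => (σ.next n).prod (τ.next n))

/-- The average set-valued payoff `(1 / T) ∑_t m (x_t, y_t)` (a Minkowski average) over the first
`T` rounds of the play `h`. -/
noncomputable def avgPayoff (m : Mixed A → Mixed B → Set (Reward d))
    (h : ℕ → Mixed A × Mixed B) (T : ℕ) : Set (Reward d) :=
  (T : ℝ)⁻¹ • ∑ t ∈ Finset.range T, m (h t).1 (h t).2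

/-- `sup_{v ∈ S} inf_{c ∈ C} ‖c - v‖`, as an extended nonnegative real. -/
noncomputable def excess (S C : Set (Reward d)) : ℝ≥0∞ :=
  ⨆ v ∈ S, Metric.infEDist v C

/-- `C` is `m`-robust approachable with mixed actions. As `m` is an arbitrary set-valued function,
the event below need not be measurable; that its probability is at least `1 - ε` is understood in
the strong sense that it contains a measurable event of probability at least `1 - ε`. -/
def RobustApproachable (m : Mixed A → Mixed B → Set (Reward d)) (C : Set (Reward d)) : Prop :=
  ∃ σ : Strategy₁ A B, ∀ ε : ℝ, 0 < ε → ∃ T₀ : ℕ, ∀ τ : Strategy₂ A B,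
    ∃ E : Set (ℕ → Mixed A × Mixed B), MeasurableSet E ∧
      E ⊆ {h | ∀ T : ℕ, 1 ≤ T → T₀ ≤ T → excess (avgPayoff m h T) C ≤ ENNReal.ofReal ε} ∧
      ENNReal.ofReal (1 - ε) ≤ playLaw σ τ E

end Game

/-! ### Integration against the law of the play -/

section LawOfPlay

open MeasureTheory ProbabilityTheory

/-! Necessity. Let the second player repeat y forever. By concavity the average payoff contains the
payoff of the averaged action (`ConcaveFst.exists_subset_avgPayoff`), so for each ε some x has m(x,
y) within ε of C. Compactness of the simplex and continuity in x allow ε → 0.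

Sufficiency. Support functions along a dense sequence of directions p_i in the unit ball turn the
problem into scalar payoffs r_i(x, y), the support function of m(x, y) minus that of C, both at p_i.
Convexity of m in y makes r_i concave in y. For a dense sequence c_k, (RAC) yields X_k with r_i(X_k,
c_k) ≤ 0 for all i at once. Compactness and a minimax argument then show that any nonnegative
combination of finitely many r_i is kept at most 1 in expectation, whatever y, by a lottery over
finitely many X_k (`exists_weights_of_rac`). A lottery is needed because nothing is assumed about m
in x.

Blackwell's argument follows, with weights given by half the gradient of `potential`, one more
direction entering at each round. The expected increase per round is bounded (`potential_snoc_le`),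
so the expectation is O(T). Markov's inequality at the times n², a union bound, and interpolation
between squares (`sum_range_le_of_sum_sq_le`) give a time that does not depend on the opponent.
Finitely many directions then control the distance to C (`excess_avgPayoff_le`).

The r_i need not be measurable in x. So the strategy sees the past only through a countable code:
the index of X_k, and y_t rounded to some c_k with payoff error at most 2^(-t). -/

theorem map_eval_zero_trajMeasure {X : Type*} [MeasurableSpace X]
    (κ : (n : ℕ) → Kernel ((i : Finset.Iic n) → X) X) [∀ n, IsMarkovKernel (κ n)]
    (μ₀ : Measure X) :
    (Kernel.trajMeasure (X := fun _ => X) μ₀ κ).map (fun x => x 0) = μ₀ := by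
  let e : (Finset.Iic 0 → X) → X := fun z => z ⟨0, Finset.mem_Iic.2 le_rfl⟩
  have he : Measurable e := measurable_pi_apply (⟨0, Finset.mem_Iic.2 le_rfl⟩ : Finset.Iic 0)
  have h : (fun x : ℕ → X => x 0) = e ∘ Preorder.frestrictLe 0 := rfl
  have h' := Measure.map_map (μ := μ₀) he
    (MeasurableEquiv.piUnique fun _ : Finset.Iic 0 => X).symm.measurable
  rw [h, ← Measure.map_map he (by fun_prop), Kernel.trajMeasure,
    Measure.map_comp _ _ (by fun_prop), Kernel.traj_map_frestrictLe, Kernel.partialTraj_self,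
    Measure.id_comp]
  exact h'.trans Measure.map_id

variable {A B : Type*} [Fintype A] [Fintype B]

instance (σ : Strategy₁ A B) (τ : Strategy₂ A B) : IsProbabilityMeasure (playLaw σ τ) := by
  unfold playLaw; infer_instance

theorem lintegral_playLaw_zero (σ : Strategy₁ A B) (τ : Strategy₂ A B)
    {g : Mixed A × Mixed B → ℝ≥0∞} (hg : Measurable g) :
    ∫⁻ h, g (h 0) ∂(playLaw σ τ) = ∫⁻ y, ∫⁻ x, g (x, y) ∂σ.init ∂τ.init := by
  rw [← lintegral_prod_symm' _ hg]
  conv_rhs => rw [← map_eval_zero_trajMeasure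
    (fun n => (σ.next n).prod (τ.next n)) (σ.init.prod τ.init)]
  rw [lintegral_map hg (by fun_prop)]
  rfl

/-- Independence given the past allows x to be integrated innermost, with y frozen; a bound uniform
in y then passes through any strategy of the opponent. -/
theorem lintegral_playLaw_succ (σ : Strategy₁ A B) (τ : Strategy₂ A B) (n : ℕ)
    {g : ((i : Finset.Iic n) → Mixed A × Mixed B) × (Mixed A × Mixed B) → ℝ≥0∞}
    (hg : Measurable g) :
    ∫⁻ h, g (Preorder.frestrictLe n h, h (n + 1)) ∂(playLaw σ τ) =
      ∫⁻ h, ∫⁻ y, ∫⁻ x, g (Preorder.frestrictLe n h, (x, y))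
        ∂(σ.next n (Preorder.frestrictLe n h)) ∂(τ.next n (Preorder.frestrictLe n h))
        ∂(playLaw σ τ) := by
  have key := Kernel.map_frestrictLe_trajMeasure_compProd_eq_map_trajMeasure
    (X := fun _ => Mixed A × Mixed B) (μ₀ := σ.init.prod τ.init)
    (κ := fun n => (σ.next n).prod (τ.next n)) (a := n)
  have h1 := lintegral_map (μ := playLaw σ τ) hg
    (g := fun h => (Preorder.frestrictLe n h, h (n + 1))) (by fun_prop)
  rw [← h1]
  unfold playLaw
  rw [← key, Measure.lintegral_compProd hg, lintegral_map _ (by fun_prop)]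
  · refine lintegral_congr fun h => ?_
    rw [Kernel.prod_apply, lintegral_prod_symm']
    exact hg.comp (by fun_prop)
  · exact hg.lintegral_kernel_prod_right'

theorem ae_playLaw_fst_mem (σ : Strategy₁ A B) (τ : Strategy₂ A B) {S : Set (Mixed A)}
    (hS : MeasurableSet S) (h0 : σ.init Sᶜ = 0) (h1 : ∀ n k, σ.next n k Sᶜ = 0) :
    ∀ᵐ h ∂(playLaw σ τ), ∀ t, (h t).1 ∈ S := by
  have hind : Measurable (Sᶜ.indicator (1 : Mixed A → ℝ≥0∞)) :=
    measurable_one.indicator hS.compl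
  refine ae_all_iff.2 fun t => ?_
  have hz : ∫⁻ h, Sᶜ.indicator 1 (h t).1 ∂(playLaw σ τ) = 0 := by
    cases t with
    | zero =>
      rw [lintegral_playLaw_zero σ τ (g := fun z => Sᶜ.indicator 1 z.1) (by fun_prop)]
      simp [lintegral_indicator_one hS.compl, h0]
    | succ n =>
      rw [lintegral_playLaw_succ σ τ n (g := fun z => Sᶜ.indicator 1 z.2.1) (by fun_prop)]
      simp [lintegral_indicator_one hS.compl, h1]
  rw [lintegral_eq_zero_iff (by fun_prop)] at hz
  filter_upwards [hz] with h hh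
  by_contra hc
  simp [hc] at hh

theorem ae_playLaw_snd_mem (σ : Strategy₁ A B) (τ : Strategy₂ A B) {S : Set (Mixed B)}
    (hS : MeasurableSet S) (h0 : τ.init Sᶜ = 0) (h1 : ∀ n k, τ.next n k Sᶜ = 0) :
    ∀ᵐ h ∂(playLaw σ τ), ∀ t, (h t).2 ∈ S := by
  have hind : Measurable (Sᶜ.indicator (1 : Mixed B → ℝ≥0∞)) :=
    measurable_one.indicator hS.compl
  refine ae_all_iff.2 fun t => ?_
  have hz : ∫⁻ h, Sᶜ.indicator 1 (h t).2 ∂(playLaw σ τ) = 0 := by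
    cases t with
    | zero =>
      rw [lintegral_playLaw_zero σ τ (g := fun z => Sᶜ.indicator 1 z.2) (by fun_prop)]
      simp [lintegral_indicator_one hS.compl, h0]
    | succ n =>
      rw [lintegral_playLaw_succ σ τ n (g := fun z => Sᶜ.indicator 1 z.2.2) (by fun_prop)]
      simp [lintegral_indicator_one hS.compl, h1]
  rw [lintegral_eq_zero_iff (by fun_prop)] at hz
  filter_upwards [hz] with h hh
  by_contra hc
  simp [hc] at hh

/-- The strategy that draws its moves from a fixed distribution, whatever the past. -/
noncomputable def Strategy.const (H : Type*) {S : Type*} [MeasurableSpace H] [MeasurableSpace S]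
    (μ : Measure S) [IsProbabilityMeasure μ] : Strategy H S where
  init := μ
  next _ := Kernel.const _ μ
  init_prob := inferInstance
  next_markov _ := inferInstance

/-- The strategy that draws the move of round `n` from a distribution depending on the values
of countably-valued observations of the outcomes of the earlier rounds. -/
noncomputable def Strategy.ofCode {H S K : Type*} [MeasurableSpace H] [MeasurableSpace S]
    [MeasurableSpace K] [MeasurableSingletonClass K] [Countable K]
    (c : ℕ → H → K) (hc : ∀ n, Measurable (c n))
    (ν : (n : ℕ) → (Fin n → K) → Measure S) (hν : ∀ n k, IsProbabilityMeasure (ν n k)) :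
    Strategy H S where
  init := ν 0 Fin.elim0
  -- Codes of the past form a countable discrete space, so any family of laws indexed by them is a
  -- kernel.
  next n := (Kernel.ofFunOfCountable (ν (n + 1))).comap
    (fun z (i : Fin (n + 1)) => c i (z ⟨i, Finset.mem_Iic.2 (Nat.lt_succ_iff.1 i.2)⟩))
    (measurable_pi_iff.2 fun i => (hc i).comp (measurable_pi_apply _))
  init_prob := hν _ _
  next_markov _ := ⟨fun _ => hν _ _⟩

/-- If the conditional expectation of a potential increases by at most `b` per round, then its
expectation grows at most linearly, whatever the opponent does. -/
theorem lintegral_ofCode_le {K : Type*} [MeasurableSpace K] [MeasurableSingletonClass K]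
    [Countable K] (c : ℕ → Mixed A × Mixed B → K) (hc : ∀ n, Measurable (c n))
    (ν : (n : ℕ) → (Fin n → K) → Measure (Mixed A)) (hν : ∀ n k, IsProbabilityMeasure (ν n k))
    (V : (n : ℕ) → (Fin n → K) → ℝ≥0∞) (b : ℝ≥0∞)
    (hV : ∀ n k y, ∫⁻ x, V (n + 1) (Fin.snoc k (c n (x, y))) ∂(ν n k) ≤ V n k + b)
    (τ : Strategy₂ A B) (T : ℕ) :
    ∫⁻ h, V T (fun i => c i (h i)) ∂(playLaw (Strategy.ofCode c hc ν hν) τ) ≤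
      V 0 Fin.elim0 + T * b := by
  induction T with
  | zero =>
    have : ∀ h : ℕ → Mixed A × Mixed B, (fun i : Fin 0 => c i (h i)) = Fin.elim0 :=
      fun h => Subsingleton.elim _ _
    simp [this]
  | succ n ih =>
    have hsnoc : ∀ h : ℕ → Mixed A × Mixed B, (fun i : Fin (n + 1) => c i (h i)) =
        Fin.snoc (fun i : Fin n => c i (h i)) (c n (h n)) := by
      intro h
      ext i
      refine Fin.lastCases ?_ (fun j => ?_) i <;> simp
    have hVm : ∀ n, Measurable (V n) := fun n => measurable_of_countable _
    have hle : ∫⁻ h, V (n + 1) (fun i => c i (h i))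
        ∂(playLaw (Strategy.ofCode c hc ν hν) τ) ≤
        ∫⁻ h, (V n (fun i => c i (h i)) + b) ∂(playLaw (Strategy.ofCode c hc ν hν) τ) := by
      simp_rw [hsnoc]
      -- Round 0 is drawn from `init`, not from a kernel, hence the separate case.
      cases n with
      | zero =>
        have he : ∀ h : ℕ → Mixed A × Mixed B, (fun i : Fin 0 => c i (h i)) = Fin.elim0 :=
          fun h => Subsingleton.elim _ _
        simp_rw [he]
        rw [lintegral_playLaw_zero _ τ (g := fun z => V 1 (Fin.snoc Fin.elim0 (c 0 z)))
          (((hVm 1).comp (measurable_of_countable (fun a => Fin.snoc Fin.elim0 a))).comp (hc 0))]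
        refine (lintegral_mono fun y => hV 0 Fin.elim0 y).trans ?_
        simp
      | succ n =>
        have hcode : Measurable (fun z : (i : Finset.Iic n) → Mixed A × Mixed B =>
            fun i : Fin (n + 1) => c i (z ⟨i, Finset.mem_Iic.2 (Nat.lt_succ_iff.1 i.2)⟩)) :=
          measurable_pi_iff.2 fun i => (hc i).comp (measurable_pi_apply _)
        have := lintegral_playLaw_succ (Strategy.ofCode c hc ν hν) τ n
          (g := fun z => V (n + 2) (Fin.snoc
            (fun i : Fin (n + 1) => c i (z.1 ⟨i, Finset.mem_Iic.2 (Nat.lt_succ_iff.1 i.2)⟩))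
            (c (n + 1) z.2))) ?_
        · refine this.le.trans (lintegral_mono fun h => ?_)
          refine (lintegral_mono fun y => hV (n + 1) _ y).trans ?_
          simp
        · exact ((hVm (n + 2)).comp (measurable_of_countable
            (fun a : (Fin (n + 1) → K) × K => (Fin.snoc a.1 a.2 : Fin (n + 2) → K)))).comp
            ((hcode.comp measurable_fst).prodMk ((hc (n + 1)).comp measurable_snd))
    refine hle.trans ?_
    rw [lintegral_add_right _ measurable_const]
    simp only [lintegral_const, measure_univ, mul_one]
    calc _ ≤ V 0 Fin.elim0 + n * b + b := by gcongr
      _ = _ := by push_cast; ring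

end LawOfPlay

/-! ### Necessity of (RAC) -/

section Necessity

open MeasureTheory ProbabilityTheory Filter Topology

variable {A B : Type*} [Fintype A] [Fintype B] {d : ℕ}

theorem continuous_l1dist : Continuous fun p : Mixed A × Mixed A => l1dist p.1 p.2 := by
  refine continuous_finsetSum _ fun a _ => Continuous.abs (Continuous.sub ?_ ?_)
  · exact (continuous_apply a).comp (continuous_subtype_val.comp continuous_fst)
  · exact (continuous_apply a).comp (continuous_subtype_val.comp continuous_snd)

@[simp] theorem l1dist_self (x : Mixed A) : l1dist x x = 0 := by simp [l1dist]

theorem l1dist_comm (x x' : Mixed A) : l1dist x x' = l1dist x' x := by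
  simp [l1dist, abs_sub_comm]

theorem ConcaveFst.exists_subset_avgPayoff {m : Mixed A → Mixed B → Set (Reward d)}
    (hm : ConcaveFst m) {h : ℕ → Mixed A × Mixed B} {y : Mixed B} (hy : ∀ t, (h t).2 = y)
    (T : ℕ) : ∃ x, m x y ⊆ avgPayoff m h (T + 1) := by
  induction T with
  | zero => exact ⟨(h 0).1, by simp [avgPayoff, hy]⟩
  | succ n ih =>
    obtain ⟨x, hx⟩ := ih
    -- The old average covers n + 1 of the n + 2 rounds.
    set α : ℝ := (n + 1) / (n + 2) with hα
    have hn : (0 : ℝ) < n + 2 := by positivity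
    have hα0 : 0 ≤ α := by positivity
    have hα1' : 1 - α = (n + 2 : ℝ)⁻¹ := by rw [hα]; field_simp; ring
    have hα1 : 0 ≤ 1 - α := by rw [hα1']; positivity
    refine ⟨⟨α • x.1 + (1 - α) • (h (n + 1)).1.1,
      convex_stdSimplex ℝ A x.2 (h (n + 1)).1.2 hα0 hα1 (by ring)⟩, ?_⟩
    refine (hm x (h (n + 1)).1 _ y α hα0 (by linarith) rfl).trans ?_
    refine (Set.add_subset_add_right (Set.smul_set_mono hx)).trans ?_
    rw [avgPayoff, avgPayoff, smul_smul, Finset.sum_range_succ _ (n + 1), smul_add, hα1', hy]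
    have h1 : α * ((n + 1 : ℕ) : ℝ)⁻¹ = (n + 2 : ℝ)⁻¹ := by
      rw [hα]; push_cast; field_simp
    have h2 : ((n + 1 + 1 : ℕ) : ℝ)⁻¹ = (n + 2 : ℝ)⁻¹ := by push_cast; ring
    rw [h1, h2]

theorem infEDist_le_of_excess_le {S C : Set (Reward d)} {a : ℝ≥0∞} (h : excess S C ≤ a)
    {v : Reward d} (hv : v ∈ S) : Metric.infEDist v C ≤ a :=
  (le_iSup₂ (f := fun v (_ : v ∈ S) => Metric.infEDist v C) v hv).trans h

theorem RobustApproachable.exists_excess_le {m : Mixed A → Mixed B → Set (Reward d)}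
    {C : Set (Reward d)} (hC : RobustApproachable m C) (hm : ConcaveFst m) (y : Mixed B)
    {ε : ℝ} (hε : 0 < ε) : ∃ x, excess (m x y) C ≤ ENNReal.ofReal ε := by
  obtain ⟨σ, hσ⟩ := hC
  -- Capping at 1/2 keeps the event of positive probability even when ε ≥ 1.
  have hε' : 0 < min ε 2⁻¹ := by positivity
  obtain ⟨T₀, hT⟩ := hσ _ hε'
  let τ : Strategy₂ A B := Strategy.const _ (Measure.dirac y)
  obtain ⟨E, -, hE, hP⟩ := hT τ
  have hpos : playLaw σ τ E ≠ 0 := by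
    refine (lt_of_lt_of_le ?_ hP).ne'
    rw [ENNReal.ofReal_pos]
    have := min_le_right ε 2⁻¹
    norm_num at this ⊢
  have hae : ∀ᵐ h ∂(playLaw σ τ), ∀ t, (h t).2 ∈ ({y} : Set (Mixed B)) := by
    refine ae_playLaw_snd_mem σ τ (measurableSet_singleton y) ?_ fun n k => ?_ <;>
    simp [τ, Strategy.const]
  obtain ⟨h, hhE, hhy⟩ : ∃ h ∈ E, ∀ t, (h t).2 = y := by
    -- A set of positive probability meets an almost sure one; a single such play suffices.
    by_contra! hcon
    refine hpos (measure_mono_null (fun h hh => ?_) (ae_iff.1 hae))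
    simpa using hcon h hh
  obtain ⟨x, hx⟩ := hm.exists_subset_avgPayoff hhy T₀
  refine ⟨x, (biSup_mono fun v hv => hx hv).trans ((hE hhE (T₀ + 1) (by omega) (by omega)).trans ?_)⟩
  exact ENNReal.ofReal_le_ofReal (min_le_left _ _)

theorem RobustApproachable.rac {m : Mixed A → Mixed B → Set (Reward d)} {C : Set (Reward d)}
    (hC : RobustApproachable m C) (hclosed : IsClosed C) (hm : ConcaveFst m)
    (hcont : UnifContFst m) : RAC m C := by
  intro y
  choose x hx using fun n : ℕ =>
    hC.exists_excess_le hm y (ε := 1 / ((n : ℝ) + 1)) Nat.one_div_pos_of_nat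
  obtain ⟨z, φ, hφ, hlim⟩ := CompactSpace.tendsto_subseq x
  refine ⟨z, fun v hv => ?_⟩
  rw [← hclosed.closure_eq, Metric.mem_closure_iff_infEDist_zero]
  refine le_antisymm (ENNReal.le_of_forall_pos_le_add fun ε hε _ => ?_) bot_le
  have hε2 : (0 : ℝ) < ε / 2 := by positivity
  obtain ⟨η, hη, hsub⟩ := hcont (ε / 2) hε2
  have h1 : ∀ᶠ n in atTop, l1dist (x (φ n)) z ≤ η := by
    have hc : Continuous fun w : Mixed A => l1dist w z :=
      continuous_l1dist.comp (continuous_id.prodMk continuous_const)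
    have h0 := hc.tendsto z
    rw [l1dist_self] at h0
    exact hlim.eventually (h0.eventually_le_const hη)
  have h2 : ∀ᶠ n in atTop, 1 / ((φ n : ℝ) + 1) ≤ ε / 2 :=
    (tendsto_one_div_add_atTop_nhds_zero_nat.comp hφ.tendsto_atTop).eventually_le_const hε2
  obtain ⟨n, hn1, hn2⟩ := (h1.and h2).exists
  obtain ⟨u, hu, b, hb, rfl⟩ := hsub _ _ hn1 y hv
  have hb' : edist (u + b) u ≤ ENNReal.ofReal (ε / 2) := by
    rw [edist_dist, dist_eq_norm, add_sub_cancel_left]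
    exact ENNReal.ofReal_le_ofReal (by simpa using hb)
  calc Metric.infEDist (u + b) C ≤ Metric.infEDist u C + edist (u + b) u :=
        Metric.infEDist_le_infEDist_add_edist
    _ ≤ ENNReal.ofReal (ε / 2) + ENNReal.ofReal (ε / 2) := by
        gcongr
        exact (infEDist_le_of_excess_le (hx (φ n)) hu).trans (ENNReal.ofReal_le_ofReal hn2)
    _ = 0 + ε := by
        rw [← ENNReal.ofReal_add hε2.le hε2.le, add_halves, ENNReal.ofReal_coe_nnreal, zero_add]

end Necessity

/-! ### A minimax theorem by separation -/

section Minimax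

/-- A minimax theorem for finitely many concave functions: if one of them is at most `δ` at
each point of a convex set, then some convex combination is at most `δ` on the whole set. -/
theorem exists_weights_of_concaveOn {E : Type*} [AddCommGroup E] [Module ℝ E] {s : Set E}
    (hs : Convex ℝ s) (hne : s.Nonempty) {N : ℕ} {f : Fin N → E → ℝ}
    (hf : ∀ k, ConcaveOn ℝ s (f k)) {δ : ℝ} (h : ∀ y ∈ s, ∃ k, f k y ≤ δ) :
    ∃ q ∈ stdSimplex ℝ (Fin N), ∀ y ∈ s, ∑ k, q k * f k y ≤ δ := by
  let U : Set (Fin N → ℝ) := {v | ∀ k, δ < v k}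
  -- Taking everything below the graph, not just the image, is what makes this set convex for
  -- concave `f k`.
  let W : Set (Fin N → ℝ) := {v | ∃ y ∈ s, ∀ k, v k ≤ f k y}
  have hUpi : U = Set.univ.pi fun _ => Set.Ioi δ := by ext; simp [U]
  have hUc : Convex ℝ U := hUpi ▸ convex_pi fun _ _ => convex_Ioi δ
  have hUo : IsOpen U := hUpi ▸ isOpen_set_pi Set.finite_univ fun _ _ => isOpen_Ioi
  have hWc : Convex ℝ W := by
    rintro v ⟨y, hy, hv⟩ v' ⟨y', hy', hv'⟩ a b ha hb hab
    refine ⟨a • y + b • y', hs hy hy' ha hb hab, fun k => ?_⟩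
    refine le_trans ?_ ((hf k).2 hy hy' ha hb hab)
    simp only [Pi.add_apply, Pi.smul_apply, smul_eq_mul]
    gcongr
    exacts [hv k, hv' k]
  have hdisj : Disjoint U W := by
    rw [Set.disjoint_left]
    rintro v hvU ⟨y, hy, hv⟩
    obtain ⟨k, hk⟩ := h y hy
    exact absurd (hvU k) (not_lt.2 ((hv k).trans hk))
  obtain ⟨g, u, hgU, hgW⟩ := geometric_hahn_banach_open hUc hUo hWc hdisj
  set c : Fin N → ℝ := fun k => -g (Pi.single k 1) with hc
  have hg : ∀ v : Fin N → ℝ, g v = -∑ k, c k * v k := by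
    intro v
    conv_lhs => rw [pi_eq_sum_univ' v]
    simp only [map_sum, hc, neg_mul, Finset.sum_neg_distrib, neg_neg]
    refine Finset.sum_congr rfl fun k _ => ?_
    simp [mul_comm]
  obtain ⟨y₀, hy₀⟩ := hne
  have hc0 : ∀ k, 0 ≤ c k := by
    intro k
    by_contra! hk
    -- `W` is stable under lowering coordinate k, while `g` is bounded below on it; letting t grow
    -- excludes a negative weight.
    have hb : ∀ t : ℝ, 0 ≤ t → u ≤ g (fun j => f j y₀) + t * c k := by
      intro t ht
      have := hgW ((fun j => f j y₀) - t • Pi.single k 1) ⟨y₀, hy₀, fun j => by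
        by_cases hj : j = k
        · subst hj; simp [ht]
        · simp [hj]⟩
      rw [map_sub, map_smul, smul_eq_mul] at this
      simp only [hc]
      linarith
    have h0 := hb 0 le_rfl
    have h1 := hb ((g (fun j => f j y₀) - u + 1) / (-c k)) (by
      apply div_nonneg <;> linarith)
    have : (g (fun j => f j y₀) - u + 1) / (-c k) * c k = -(g (fun j => f j y₀) - u + 1) := by
      field_simp [hk.ne]
    linarith
  have hmain : ∀ y ∈ s, ∀ e > 0, ∑ k, c k * f k y < (δ + e) * ∑ k, c k := by
    intro y hy e he
    have h1 := hgU (fun _ => δ + e) (fun _ => by linarith)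
    have h2 := hgW (fun k => f k y) ⟨y, hy, fun _ => le_rfl⟩
    rw [hg] at h1 h2
    rw [← Finset.sum_mul] at h1
    linarith [mul_comm (δ + e) (∑ k, c k)]
  have hS : 0 < ∑ k, c k := by
    -- All weights zero would turn the strict separation into 0 < 0.
    refine lt_of_le_of_ne (Finset.sum_nonneg fun k _ => hc0 k) fun hS => ?_
    have hz : ∀ k, c k = 0 := fun k =>
      (Finset.sum_eq_zero_iff_of_nonneg fun k _ => hc0 k).1 hS.symm k (Finset.mem_univ k)
    have := hmain y₀ hy₀ 1 one_pos
    simp [hz] at this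
  refine ⟨fun k => c k / ∑ j, c j, ⟨fun k => div_nonneg (hc0 k) hS.le, ?_⟩, fun y hy => ?_⟩
  · rw [← Finset.sum_div, div_self hS.ne']
  · have : ∑ k, c k / (∑ j, c j) * f k y = (∑ k, c k * f k y) / ∑ j, c j := by
      rw [Finset.sum_div]
      exact Finset.sum_congr rfl fun k _ => by ring
    rw [this, div_le_iff₀ hS]
    refine le_of_forall_pos_le_add fun e he => ?_
    have := (hmain y hy (e / ∑ j, c j) (by positivity)).le
    rwa [add_mul, div_mul_cancel₀ _ hS.ne'] at this

end Minimax

/-! ### Support functions -/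

section SupportFunction

open scoped RealInnerProductSpace

variable {E : Type*} [NormedAddCommGroup E] [InnerProductSpace ℝ E] {S S' S'' : Set E}
  {M : ℝ} {p p' : E}

/-- The support function of a set. -/
noncomputable def supportFun (S : Set E) (p : E) : ℝ := sSup ((fun v => ⟪p, v⟫) '' S)

theorem inner_le_supportFun (hS : ∀ v ∈ S, ‖v‖ ≤ M) {v : E} (hv : v ∈ S) :
    ⟪p, v⟫ ≤ supportFun S p := by
  refine le_csSup ⟨‖p‖ * M, ?_⟩ ⟨v, hv, rfl⟩
  rintro _ ⟨w, hw, rfl⟩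
  exact (real_inner_le_norm p w).trans (by gcongr; exact hS w hw)

theorem supportFun_le (hne : S.Nonempty) {a : ℝ} (h : ∀ v ∈ S, ⟪p, v⟫ ≤ a) :
    supportFun S p ≤ a :=
  csSup_le (hne.image _) (by rintro _ ⟨v, hv, rfl⟩; exact h v hv)

theorem abs_supportFun_le (hS : ∀ v ∈ S, ‖v‖ ≤ M) (hne : S.Nonempty) (hp : ‖p‖ ≤ 1) :
    |supportFun S p| ≤ M := by
  have hb : ∀ v ∈ S, |⟪p, v⟫| ≤ M := fun v hv =>
    (abs_real_inner_le_norm p v).trans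
      ((mul_le_of_le_one_left (norm_nonneg v) hp).trans (hS v hv))
  obtain ⟨v, hv⟩ := hne
  exact abs_le.2 ⟨(abs_le.1 (hb v hv)).1.trans (inner_le_supportFun hS hv),
    supportFun_le ⟨v, hv⟩ fun w hw => (abs_le.1 (hb w hw)).2⟩

theorem supportFun_le_add (hS : ∀ v ∈ S, ‖v‖ ≤ M) (hne : S.Nonempty) :
    supportFun S p ≤ supportFun S p' + ‖p - p'‖ * M := by
  refine supportFun_le hne fun v hv => ?_
  have h1 := inner_le_supportFun (p := p') hS hv
  have h2 : ⟪p - p', v⟫ ≤ ‖p - p'‖ * M :=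
    (real_inner_le_norm _ _).trans (by gcongr; exact hS v hv)
  rw [inner_sub_left] at h2
  linarith

theorem supportFun_le_add_of_subset (hS : ∀ v ∈ S, ‖v‖ ≤ M) (hne : S'.Nonempty)
    {ε : ℝ} (hp : ‖p‖ ≤ 1) (hsub : S' ⊆ S + Metric.closedBall 0 ε) :
    supportFun S' p ≤ supportFun S p + ε := by
  refine supportFun_le hne fun v hv => ?_
  obtain ⟨u, hu, b, hb, rfl⟩ := hsub hv
  have h1 := inner_le_supportFun (p := p) hS hu
  have h2 : ⟪p, b⟫ ≤ ε := (real_inner_le_norm _ _).trans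
    ((mul_le_of_le_one_left (norm_nonneg b) hp).trans (by simpa using hb))
  change ⟪p, u + b⟫ ≤ _
  rw [inner_add_right]
  linarith

/-- Applied to convexity of m in y, this is the concavity of r_i in y. The suprema over the two sets
are taken one after the other; a zero coefficient is treated apart because the others are divided
out. -/
theorem le_supportFun_of_smul_add_smul_subset (hS : ∀ v ∈ S'', ‖v‖ ≤ M) (hne : S.Nonempty)
    (hne' : S'.Nonempty) {a b : ℝ} (ha : 0 ≤ a) (hb : 0 ≤ b)
    (hsub : a • S + b • S' ⊆ S'') :
    a * supportFun S p + b * supportFun S' p ≤ supportFun S'' p := by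
  have key : ∀ v ∈ S, ∀ v' ∈ S', a * ⟪p, v⟫ + b * ⟪p, v'⟫ ≤ supportFun S'' p := by
    intro v hv v' hv'
    have := inner_le_supportFun (p := p) hS
      (hsub (Set.add_mem_add (Set.smul_mem_smul_set hv) (Set.smul_mem_smul_set hv')))
    rwa [inner_add_right, real_inner_smul_right, real_inner_smul_right] at this
  have h1 : ∀ v ∈ S, a * ⟪p, v⟫ + b * supportFun S' p ≤ supportFun S'' p := by
    intro v hv
    rcases hb.eq_or_lt with rfl | hb
    · obtain ⟨v', hv'⟩ := hne'
      simpa using key v hv v' hv'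
    · have : supportFun S' p ≤ (supportFun S'' p - a * ⟪p, v⟫) / b :=
        supportFun_le hne' fun v' hv' => by
          rw [le_div_iff₀ hb]; linarith [key v hv v' hv', mul_comm b ⟪p, v'⟫]
      rw [le_div_iff₀ hb] at this
      linarith [mul_comm b (supportFun S' p)]
  rcases ha.eq_or_lt with rfl | ha
  · obtain ⟨v, hv⟩ := hne
    simpa using h1 v hv
  · have : supportFun S p ≤ (supportFun S'' p - b * supportFun S' p) / a :=
      supportFun_le hne fun v hv => by
        rw [le_div_iff₀ ha]; linarith [h1 v hv, mul_comm a ⟪p, v⟫]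
    rw [le_div_iff₀ ha] at this
    linarith [mul_comm a (supportFun S p)]

/-- Distance to a closed convex set, as controlled by support functions. -/
theorem infEDist_le_of_inner_le [CompleteSpace E] {C : Set E} (hne : C.Nonempty)
    (hclosed : IsClosed C) (hconvex : Convex ℝ C) {v : E} {ε : ℝ}
    (h : ∀ p : E, ‖p‖ ≤ 1 → ⟪p, v⟫ ≤ supportFun C p + ε) :
    Metric.infEDist v C ≤ ENNReal.ofReal ε := by
  obtain ⟨c, hc, hmin⟩ := exists_norm_eq_iInf_of_complete_convex hne hclosed.isComplete hconvex v
  rw [norm_eq_iInf_iff_real_inner_le_zero hconvex hc] at hmin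
  refine (Metric.infEDist_le_edist_of_mem hc).trans ?_
  rw [edist_dist, dist_eq_norm]
  refine ENNReal.ofReal_le_ofReal ?_
  -- The test direction points from the projection c to v. If v = c, the convention 0⁻¹ = 0 makes it
  -- zero, still in the unit ball.
  have hp : ‖(‖v - c‖⁻¹) • (v - c)‖ ≤ 1 := by
    rw [norm_smul, norm_inv, norm_norm]
    exact inv_mul_le_one
  have h1 := h _ hp
  have h2 : supportFun C ((‖v - c‖⁻¹) • (v - c)) ≤ ⟪(‖v - c‖⁻¹) • (v - c), c⟫ := by
    refine supportFun_le hne fun w hw => ?_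
    have := hmin w hw
    rw [inner_sub_right] at this
    rw [real_inner_smul_left, real_inner_smul_left]
    gcongr
    linarith
  have h3 : ⟪(‖v - c‖⁻¹) • (v - c), v - c⟫ = ‖v - c‖ := by
    rw [real_inner_smul_left, real_inner_self_eq_norm_sq]
    rcases eq_or_ne ‖v - c‖ 0 with h0 | h0
    · simp [h0]
    · field_simp
  rw [inner_sub_right] at h3
  linarith

end SupportFunction

/-! ### The potential and its increments -/

section Potential

/-- The weighted sum of the squared positive parts of the cumulative payoffs along the first `n`
directions after `n` rounds. -/
noncomputable def potential {K : Type*} (u : ℕ → K → ℝ) (n : ℕ) (k : Fin n → K) : ℝ :=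
  ∑ i ∈ Finset.range n, ((i : ℝ) + 1)⁻¹ ^ 2 * max 0 (∑ t, u i (k t)) ^ 2

theorem sum_inv_succ_sq_le (n : ℕ) :
    ∑ i ∈ Finset.range (n + 1), ((i : ℝ) + 1)⁻¹ ^ 2 ≤ 2 - ((n : ℝ) + 1)⁻¹ := by
  induction n with
  | zero => norm_num
  | succ n ih =>
    rw [Finset.sum_range_succ]
    have h : ((n + 1 : ℕ) + 1 : ℝ)⁻¹ ^ 2 ≤ ((n : ℝ) + 1)⁻¹ - ((n + 1 : ℕ) + 1 : ℝ)⁻¹ := by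
      push_cast
      rw [inv_sub_inv (by positivity) (by positivity), inv_pow, ← one_div,
        div_le_div_iff₀ (by positivity) (by positivity)]
      have : (0 : ℝ) ≤ n := n.cast_nonneg
      nlinarith
    linarith

theorem sq_max_zero_add_le (s r : ℝ) :
    max 0 (s + r) ^ 2 ≤ max 0 s ^ 2 + 2 * (max 0 s * r) + r ^ 2 := by
  have h : max 0 (s + r) ≤ |max 0 s + r| := by
    refine max_le (abs_nonneg _) (le_trans ?_ (le_abs_self _))
    gcongr
    exact le_max_right _ _
  calc max 0 (s + r) ^ 2 ≤ |max 0 s + r| ^ 2 := by gcongr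
    _ = _ := by rw [sq_abs]; ring

/-- Of the 3R², 2R² comes from the squares of the new payoffs, as the weights sum to at most 2, and
R² from the direction entering at this round, whose past sum is at most n|R| against a weight 1/(n +
1)². -/
theorem potential_snoc_le {K : Type*} {u : ℕ → K → ℝ} {R : ℝ} (hu : ∀ i z, |u i z| ≤ R)
    (n : ℕ) (k : Fin n → K) (z : K) :
    potential u (n + 1) (Fin.snoc k z) ≤ potential u n k + 3 * R ^ 2 +
      2 * ∑ i ∈ Finset.range (n + 1),
        ((i : ℝ) + 1)⁻¹ ^ 2 * max 0 (∑ t, u i (k t)) * u i z := by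
  have hsq : ∀ i, u i z ^ 2 ≤ R ^ 2 := fun i => sq_le_sq' (by linarith [(abs_le.1 (hu i z)).1])
    (abs_le.1 (hu i z)).2
  have hsum : ∀ i, max 0 (∑ t, u i (k t)) ≤ n * |R| := by
    intro i
    refine max_le (by positivity) ?_
    calc ∑ t, u i (k t) ≤ ∑ _t : Fin n, |R| :=
          Finset.sum_le_sum fun t _ => (le_abs_self _).trans ((hu i _).trans (le_abs_self R))
      _ = n * |R| := by simp
  have hlast : ((n : ℝ) + 1)⁻¹ ^ 2 * max 0 (∑ t, u n (k t)) ^ 2 ≤ R ^ 2 := by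
    calc ((n : ℝ) + 1)⁻¹ ^ 2 * max 0 (∑ t, u n (k t)) ^ 2
        ≤ ((n : ℝ) + 1)⁻¹ ^ 2 * (((n : ℝ) + 1) * |R|) ^ 2 := by
          gcongr
          exact (hsum n).trans (by gcongr; linarith)
      _ = R ^ 2 := by rw [mul_pow, sq_abs]; field_simp
  have hw : ∑ i ∈ Finset.range (n + 1), ((i : ℝ) + 1)⁻¹ ^ 2 * u i z ^ 2 ≤ 2 * R ^ 2 := by
    calc _ ≤ ∑ i ∈ Finset.range (n + 1), ((i : ℝ) + 1)⁻¹ ^ 2 * R ^ 2 := by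
          exact Finset.sum_le_sum fun i _ => mul_le_mul_of_nonneg_left (hsq i) (by positivity)
      _ ≤ 2 * R ^ 2 := by
          rw [← Finset.sum_mul]
          gcongr
          refine (sum_inv_succ_sq_le n).trans ?_
          have : (0 : ℝ) ≤ ((n : ℝ) + 1)⁻¹ := by positivity
          linarith
  calc potential u (n + 1) (Fin.snoc k z)
      ≤ ∑ i ∈ Finset.range (n + 1), ((i : ℝ) + 1)⁻¹ ^ 2 * (max 0 (∑ t, u i (k t)) ^ 2 +
          2 * (max 0 (∑ t, u i (k t)) * u i z) + u i z ^ 2) := by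
        unfold potential
        gcongr with i
        rw [Fin.sum_univ_castSucc]
        simp only [Fin.snoc_castSucc, Fin.snoc_last]
        exact sq_max_zero_add_le _ _
    _ = (potential u n k + ((n : ℝ) + 1)⁻¹ ^ 2 * max 0 (∑ t, u n (k t)) ^ 2) +
          2 * ∑ i ∈ Finset.range (n + 1),
            ((i : ℝ) + 1)⁻¹ ^ 2 * max 0 (∑ t, u i (k t)) * u i z +
          ∑ i ∈ Finset.range (n + 1), ((i : ℝ) + 1)⁻¹ ^ 2 * u i z ^ 2 := by
        unfold potential
        rw [← Finset.sum_range_succ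
          (fun i : ℕ => ((i : ℝ) + 1)⁻¹ ^ 2 * max 0 (∑ t, u i (k t)) ^ 2) n,
          Finset.mul_sum, ← Finset.sum_add_distrib, ← Finset.sum_add_distrib]
        exact Finset.sum_congr rfl fun i _ => by ring
    _ ≤ _ := by linarith

end Potential

/-! ### Blackwell's strategy on countable codes -/

section BlackwellStrategy

open MeasureTheory ProbabilityTheory

variable {A B : Type*} [Fintype A] [Fintype B]

/-- The least index works; it recovers only the value since X may repeat. Points outside the
countable range get a default index. -/
theorem exists_measurable_leftInverse {S : Type*} [MeasurableSpace S] [MeasurableSingletonClass S]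
    (X : ℕ → S) : ∃ idx : S → ℕ, Measurable idx ∧ ∀ k, X (idx (X k)) = X k := by
  classical
  have hp : ∀ x, ∃ N, X N = x ∨ x ∉ Set.range X := fun x => by
    by_cases h : x ∈ Set.range X
    · obtain ⟨k, hk⟩ := h
      exact ⟨k, Or.inl hk⟩
    · exact ⟨0, Or.inr h⟩
  refine ⟨fun x => Nat.find (hp x), measurable_find hp fun N => ?_, fun k => ?_⟩
  · have : {x | X N = x ∨ x ∉ Set.range X} = {X N} ∪ (Set.range X)ᶜ := by
      ext x; simp [eq_comm]
    rw [this]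
    exact (measurableSet_singleton _).union (Set.countable_range X).measurableSet.compl
  · exact (Nat.find_spec (hp (X k))).resolve_right fun h => h ⟨k, rfl⟩

/-- Blackwell's strategy for a sequence of real-valued payoffs `r i` to be made asymptotically
nonpositive, when the moves of the second player are observed through a discretization. -/
theorem exists_strategy_lintegral_potential_le {r : ℕ → Mixed A → Mixed B → ℝ} {R : ℝ}
    (hR : ∀ i x y, |r i x y| ≤ R) (X : ℕ → Mixed A) (c : ℕ → Mixed B) (ρ : ℕ → Mixed B → ℕ)
    (hρ : ∀ t, Measurable (ρ t))
    (hsel : ∀ n (a : ℕ → ℝ), (∀ i, 0 ≤ a i) → ∃ N, ∃ q ∈ stdSimplex ℝ (Fin N), ∀ y,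
      ∑ k, q k * ∑ i ∈ Finset.range n, a i * r i (X k) y ≤ 1) :
    ∃ (σ : Strategy₁ A B) (F : ℕ → (ℕ → Mixed A × Mixed B) → ℝ≥0∞),
      (∀ T, Measurable (F T)) ∧
      (∀ h, (∀ t, (h t).1 ∈ Set.range X) → ∀ T, F T h = ENNReal.ofReal
        (∑ i ∈ Finset.range T, ((i : ℝ) + 1)⁻¹ ^ 2 *
          max 0 (∑ t ∈ Finset.range T, r i (h t).1 (c (ρ t (h t).2))) ^ 2)) ∧
      ∀ τ : Strategy₂ A B, (∀ᵐ h ∂(playLaw σ τ), ∀ t, (h t).1 ∈ Set.range X) ∧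
        ∀ T, ∫⁻ h, F T h ∂(playLaw σ τ) ≤ T * ENNReal.ofReal (3 * R ^ 2 + 2) := by
  obtain ⟨idx, hidx, hXidx⟩ := exists_measurable_leftInverse X
  let u : ℕ → ℕ × ℕ → ℝ := fun i z => r i (X z.1) (c z.2)
  let a : (n : ℕ) → (Fin n → ℕ × ℕ) → ℕ → ℝ := fun n k i =>
    ((i : ℝ) + 1)⁻¹ ^ 2 * max 0 (∑ t, u i (k t))
  have ha : ∀ n k i, 0 ≤ a n k i := fun n k i => by positivity
  -- n + 1 directions after n rounds: the one about to enter must be controlled too.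
  choose N q hq hsel using fun n k => hsel (n + 1) (a n k) (ha n k)
  let ν : (n : ℕ) → (Fin n → ℕ × ℕ) → Measure (Mixed A) := fun n k =>
    ∑ j, ENNReal.ofReal (q n k j) • Measure.dirac (X j)
  have hqsum : ∀ n k, ∑ j, ENNReal.ofReal (q n k j) = 1 := fun n k => by
    rw [← ENNReal.ofReal_sum_of_nonneg fun j _ => (hq n k).1 j, (hq n k).2, ENNReal.ofReal_one]
  have hν : ∀ n k, IsProbabilityMeasure (ν n k) := fun n k => ⟨by simp [ν, hqsum]⟩
  let cd : ℕ → Mixed A × Mixed B → ℕ × ℕ := fun t z => (idx z.1, ρ t z.2)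
  have hcd : ∀ t, Measurable (cd t) := fun t =>
    (hidx.comp measurable_fst).prodMk ((hρ t).comp measurable_snd)
  let V : (n : ℕ) → (Fin n → ℕ × ℕ) → ℝ≥0∞ := fun n k => ENNReal.ofReal (potential u n k)
  have hpot : ∀ n k, 0 ≤ potential u n k := fun n k =>
    Finset.sum_nonneg fun i _ => by positivity
  have hVstep : ∀ n k y, ∫⁻ x, V (n + 1) (Fin.snoc k (cd n (x, y))) ∂(ν n k) ≤
      V n k + ENNReal.ofReal (3 * R ^ 2 + 2) := by
    intro n k y
    have hle : ∀ j, potential u (n + 1) (Fin.snoc k (cd n (X j, y))) ≤ potential u n k +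
        3 * R ^ 2 + 2 * ∑ i ∈ Finset.range (n + 1), a n k i * r i (X j) (c (ρ n y)) := by
      intro j
      have := potential_snoc_le (u := u) (fun i z => hR i _ _) n k (cd n (X j, y))
      simpa only [u, cd, hXidx, a] using this
    simp only [ν, lintegral_finsetSum_measure, lintegral_smul_measure, lintegral_dirac,
      smul_eq_mul, V]
    simp_rw [← ENNReal.ofReal_mul ((hq n k).1 _)]
    rw [← ENNReal.ofReal_sum_of_nonneg fun j _ => mul_nonneg ((hq n k).1 j) (hpot _ _),
      ← ENNReal.ofReal_add (hpot _ _) (by positivity)]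
    refine ENNReal.ofReal_le_ofReal ?_
    calc _ ≤ ∑ j, q n k j * (potential u n k + 3 * R ^ 2 +
          2 * ∑ i ∈ Finset.range (n + 1), a n k i * r i (X j) (c (ρ n y))) := by
          gcongr with j
          · exact (hq n k).1 j
          · exact hle j
      _ = (potential u n k + 3 * R ^ 2) * ∑ j, q n k j + 2 * ∑ j, q n k j *
          ∑ i ∈ Finset.range (n + 1), a n k i * r i (X j) (c (ρ n y)) := by
          rw [Finset.mul_sum, Finset.mul_sum, ← Finset.sum_add_distrib]
          exact Finset.sum_congr rfl fun j _ => by ring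
      _ ≤ _ := by
          rw [(hq n k).2]
          linarith [hsel n k (c (ρ n y))]
  have hsupp : ∀ n k, ν n k (Set.range X)ᶜ = 0 := fun n k => by
    simp [ν]
  refine ⟨Strategy.ofCode cd hcd ν hν, fun T h => V T (fun i => cd i (h i)), fun T => ?_,
    fun h hh T => ?_, fun τ => ⟨?_, fun T => ?_⟩⟩
  · exact (measurable_of_countable (V T)).comp
      (measurable_pi_iff.2 fun i => (hcd i).comp (measurable_pi_apply _))
  · simp only [V, potential, u, cd]
    congr 1
    refine Finset.sum_congr rfl fun i _ => ?_
    rw [Finset.sum_range]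
    have : ∀ t, X (idx (h t).1) = (h t).1 := fun t => by
      obtain ⟨k, hk⟩ := hh t
      rw [← hk, hXidx]
    simp [this]
  · exact ae_playLaw_fst_mem _ τ (Set.countable_range X).measurableSet (hsupp _ _)
      fun n k => hsupp _ _
  · refine (lintegral_ofCode_le cd hcd ν hν V _ hVstep τ T).trans ?_
    simp [V, potential]

end BlackwellStrategy

/-! ### Markov's inequality along squares -/

section UnionBound

open MeasureTheory Filter Topology

/-- If the expectation of `F T` grows at most linearly in `T`, then `F (n ^ 2)` is smaller than
`δ n ^ 4` for all large `n`, with high probability and at a rate which depends only on the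
growth constant. -/
theorem exists_measure_exists_ge_le {Ω : Type*} [MeasurableSpace Ω] {b δ ε : ℝ}
    (hδ : 0 < δ) (hε : 0 < ε) {F : ℕ → Ω → ℝ≥0∞} (hF : ∀ T, Measurable (F T)) :
    ∃ N, ∀ μ : Measure Ω, (∀ T : ℕ, ∫⁻ ω, F T ω ∂μ ≤ T * ENNReal.ofReal b) →
      μ {ω | ∃ n : ℕ, N ≤ n ∧ ENNReal.ofReal (δ * (n : ℝ) ^ 4) ≤ F (n ^ 2) ω} ≤
        ENNReal.ofReal ε := by
  -- Markov at time n² gives b n² / (δ n⁴), which is summable; along all times the bound would be of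
  -- order 1/T.
  let a : ℕ → ℝ≥0∞ := fun n => ENNReal.ofReal (b / δ * (1 / (n : ℝ) ^ 2))
  have ha : ∑' n, a n ≠ ⊤ :=
    ((Real.summable_one_div_nat_pow.2 one_lt_two).mul_left (b / δ)).tsum_ofReal_ne_top
  obtain ⟨N, hN, hN1⟩ := (((ENNReal.tendsto_sum_nat_add a ha).eventually_lt_const
    (ENNReal.ofReal_pos.2 hε)).and (eventually_ge_atTop 1)).exists
  refine ⟨N, fun μ hμ => ?_⟩
  have hone : ∀ n : ℕ, 1 ≤ n →
      μ {ω | ENNReal.ofReal (δ * (n : ℝ) ^ 4) ≤ F (n ^ 2) ω} ≤ a n := by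
    intro n hn
    have hn0 : (0 : ℝ) < n := by exact_mod_cast hn
    have hpos : 0 < δ * (n : ℝ) ^ 4 := by positivity
    refine (meas_ge_le_lintegral_div (hF _).aemeasurable (ENNReal.ofReal_pos.2 hpos).ne'
      ENNReal.ofReal_ne_top).trans ?_
    refine (ENNReal.div_le_div_right (hμ _) _).trans ?_
    rw [← ENNReal.ofReal_natCast, ← ENNReal.ofReal_mul (by positivity),
      ← ENNReal.ofReal_div_of_pos hpos]
    refine (congrArg ENNReal.ofReal ?_).le
    push_cast
    field_simp
  calc _ ≤ μ (⋃ k, {ω | ENNReal.ofReal (δ * ((k + N : ℕ) : ℝ) ^ 4) ≤ F ((k + N) ^ 2) ω}) := by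
        refine measure_mono fun ω ⟨n, hn, hω⟩ => ?_
        refine Set.mem_iUnion.2 ⟨n - N, ?_⟩
        simpa only [Set.mem_ofPred_eq, Nat.sub_add_cancel hn] using hω
    _ ≤ ∑' k, a (k + N) :=
        (measure_iUnion_le _).trans (ENNReal.tsum_le_tsum fun k => hone _ (by omega))
    _ ≤ _ := hN.le

end UnionBound

/-! ### From squares to all times -/

section Interpolation

/-- The factor 1/(I + 1) absorbs the weights of the directions below I, so each sum at time n² is at
most e n². At most 2n further rounds, each contributing at most R ≤ e n / 2, cost another e n². -/
theorem sum_range_le_of_sum_sq_le {r : ℕ → ℕ → ℝ} {R e : ℝ} (he : 0 < e)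
    (hR : ∀ i t, r i t ≤ R) {N I : ℕ} (hI : I ≤ N) (hRN : 2 * R ≤ e * N)
    (h : ∀ n : ℕ, N ≤ n → ∑ i ∈ Finset.range (n ^ 2), ((i : ℝ) + 1)⁻¹ ^ 2 *
      max 0 (∑ t ∈ Finset.range (n ^ 2), r i t) ^ 2 ≤ (((I : ℝ) + 1)⁻¹ * e) ^ 2 * (n : ℝ) ^ 4)
    {T : ℕ} (hT : N ^ 2 ≤ T) {i : ℕ} (hi : i < I) :
    ∑ t ∈ Finset.range T, r i t ≤ 2 * e * T := by
  set n := Nat.sqrt T with hn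
  have hNn : N ≤ n := Nat.le_sqrt'.2 hT
  have hnT : n ^ 2 ≤ T := Nat.sqrt_le' T
  have hTn : T ≤ n ^ 2 + 2 * n := by
    have := Nat.sqrt_le_add T
    rw [← hn] at this
    nlinarith
  have hin : i < n ^ 2 := by nlinarith
  have h1 : (((i : ℝ) + 1)⁻¹ * max 0 (∑ t ∈ Finset.range (n ^ 2), r i t)) ^ 2 ≤
      (((I : ℝ) + 1)⁻¹ * e * (n : ℝ) ^ 2) ^ 2 := by
    rw [mul_pow]
    refine (Finset.single_le_sum (f := fun i : ℕ => ((i : ℝ) + 1)⁻¹ ^ 2 *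
      max 0 (∑ t ∈ Finset.range (n ^ 2), r i t) ^ 2) (fun j _ => by positivity)
      (Finset.mem_range.2 hin)).trans ((h n hNn).trans (le_of_eq (by ring)))
  have h2 := abs_le_of_sq_le_sq h1 (by positivity)
  have h3 : ∑ t ∈ Finset.range (n ^ 2), r i t ≤ e * (n : ℝ) ^ 2 := by
    refine (le_max_right 0 _).trans ?_
    have h4 := (inv_mul_le_iff₀ (by positivity)).1 ((le_abs_self _).trans h2)
    refine h4.trans ?_
    have h5 : ((i : ℝ) + 1) * ((I : ℝ) + 1)⁻¹ ≤ 1 := by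
      rw [← div_eq_mul_inv, div_le_one (by positivity)]
      have : (i : ℝ) ≤ I := by exact_mod_cast hi.le
      linarith
    calc ((i : ℝ) + 1) * (((I : ℝ) + 1)⁻¹ * e * (n : ℝ) ^ 2)
        = ((i : ℝ) + 1) * ((I : ℝ) + 1)⁻¹ * (e * (n : ℝ) ^ 2) := by ring
      _ ≤ 1 * (e * (n : ℝ) ^ 2) := by gcongr
      _ = _ := one_mul _
  have hRn : 2 * R ≤ e * n := hRN.trans (by gcongr)
  have hcast : (n : ℝ) ^ 2 ≤ T := by exact_mod_cast hnT
  have h6 : ∑ t ∈ Finset.Ico (n ^ 2) T, r i t ≤ e * (n : ℝ) ^ 2 := by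
    calc ∑ t ∈ Finset.Ico (n ^ 2) T, r i t ≤ ∑ _t ∈ Finset.Ico (n ^ 2) T, e * n / 2 :=
          Finset.sum_le_sum fun t _ => (hR i t).trans (by linarith)
      _ = ((T - n ^ 2 : ℕ) : ℝ) * (e * n / 2) := by simp
      _ ≤ (2 * n : ℝ) * (e * n / 2) := by
          gcongr
          have : T - n ^ 2 ≤ 2 * n := by omega
          exact_mod_cast this
      _ = _ := by ring
  rw [← Finset.sum_range_add_sum_Ico _ hnT]
  nlinarith

end Interpolation

/-! ### Ingredients for sufficiency -/

section Sufficiency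

open MeasureTheory ProbabilityTheory Filter Topology
open scoped RealInnerProductSpace

theorem DenseRange.exists_lt_of_compactSpace {Y : Type*} [TopologicalSpace Y] [CompactSpace Y]
    {c : ℕ → Y} (hc : DenseRange c) {D : Y → Y → ℝ} (hD : Continuous fun p : Y × Y => D p.1 p.2)
    (h0 : ∀ y, D y y = 0) {η : ℝ} (hη : 0 < η) : ∃ N, ∀ y, ∃ k < N, D (c k) y < η := by
  have hopen : ∀ k, IsOpen {y | D (c k) y < η} := fun k =>
    isOpen_lt (hD.comp (continuous_const.prodMk continuous_id)) continuous_const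
  obtain ⟨s, hs⟩ := isCompact_univ.elim_finite_subcover _ hopen fun y _ => by
    obtain ⟨k, hk⟩ := hc.exists_mem_open (s := {x | D x y < η})
      (isOpen_lt (hD.comp (continuous_id.prodMk continuous_const)) continuous_const)
      ⟨y, by simp [h0, hη]⟩
    exact Set.mem_iUnion.2 ⟨k, hk⟩
  refine ⟨s.sup id + 1, fun y => ?_⟩
  obtain ⟨k, hk, hy⟩ := Set.mem_iUnion₂.1 (hs (Set.mem_univ y))
  exact ⟨k, Nat.lt_succ_of_le (Finset.le_sup (f := id) hk), hy⟩

variable {A B : Type*} [Fintype A] [Fintype B] {d : ℕ} {m : Mixed A → Mixed B → Set (Reward d)}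
  {C : Set (Reward d)}

/-- A set within bounded distance of the empty set is empty, so emptiness is a clopen condition on
y, and the simplex is connected. -/
theorem UnifContSnd.eq_empty (hm : UnifContSnd m) {x : Mixed A} {y₀ : Mixed B}
    (h : m x y₀ = ∅) (y : Mixed B) : m x y = ∅ := by
  obtain ⟨η, hη, hsub⟩ := hm 1 one_pos
  have hstep : ∀ y y' : Mixed B, l1dist y y' ≤ η → m x y = ∅ → m x y' = ∅ := by
    intro y y' hyy' hy
    have := hsub y y' hyy' x
    rwa [hy, Set.empty_add, Set.subset_empty_iff] at this
  have hnhds : ∀ y : Mixed B, ∀ᶠ y' in 𝓝 y, l1dist y y' ≤ η := by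
    intro y
    have hc : Continuous fun w : Mixed B => l1dist y w :=
      continuous_l1dist.comp (continuous_const.prodMk continuous_id)
    have h0 := hc.tendsto y
    rw [l1dist_self] at h0
    exact h0.eventually_le_const hη
  have hclopen : IsClopen {y | m x y = ∅} := by
    refine ⟨isOpen_compl_iff.1 (isOpen_iff_mem_nhds.2 fun y hy => ?_),
      isOpen_iff_mem_nhds.2 fun y hy => ?_⟩
    · filter_upwards [hnhds y] with y' hy' he
      exact hy (hstep y' y (by rwa [l1dist_comm]) he)
    · filter_upwards [hnhds y] with y' hy' using hstep y y' hy' hy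
  have : PreconnectedSpace (Mixed B) :=
    Subtype.preconnectedSpace (convex_stdSimplex ℝ B).isPreconnected
  have huniv := hclopen.eq_univ ⟨y₀, h⟩
  exact (huniv ▸ Set.mem_univ y : y ∈ {y | m x y = ∅})

theorem robustApproachable_of_eq_empty {x : Mixed A} (h : ∀ y, m x y = ∅) :
    RobustApproachable m C := by
  refine ⟨Strategy.const _ (Measure.dirac x), fun ε hε => ⟨0, fun τ => ?_⟩⟩
  refine ⟨{h | (h 0).1 = x}, (measurable_fst.comp (measurable_pi_apply 0))
    (measurableSet_singleton x), fun g hg T hT _ => ?_, ?_⟩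
  · refine iSup₂_le fun v hv => ?_
    obtain ⟨w, hw, -⟩ := hv
    obtain ⟨f, hf, -⟩ := (Set.mem_finsetSum _ _ _).1 hw
    have := hf (Finset.mem_range.2 hT)
    rw [show (g 0).1 = x from hg, h] at this
    exact this.elim
  · have hae : ∀ᵐ g ∂(playLaw (Strategy.const _ (Measure.dirac x)) τ),
        ∀ t, (g t).1 ∈ ({x} : Set (Mixed A)) := by
      refine ae_playLaw_fst_mem _ τ (measurableSet_singleton x) ?_ fun n k => ?_ <;>
      simp [Strategy.const]
    have hmeas : MeasurableSet {h : ℕ → Mixed A × Mixed B | (h 0).1 = x} :=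
      (measurable_fst.comp (measurable_pi_apply 0)) (measurableSet_singleton x)
    rw [(mem_ae_iff_prob_eq_one hmeas).1 (hae.mono fun g hg => hg 0)]
    exact ENNReal.ofReal_le_one.2 (by linarith)

/-- Finitely many moves suffice for the first player to control, uniformly over the moves of the
second player, a finite nonnegative combination of the payoffs `r i`. -/
theorem exists_weights_of_rac {r : ℕ → Mixed A → Mixed B → ℝ} {X : ℕ → Mixed A}
    {c : ℕ → Mixed B} [Nonempty B] (hc : DenseRange c) (hX : ∀ i k, r i (X k) (c k) ≤ 0)
    (hconc : ∀ i x (y y' z : Mixed B) (a b : ℝ), 0 ≤ a → 0 ≤ b → a + b = 1 →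
      z.1 = a • y.1 + b • y'.1 → a * r i x y + b * r i x y' ≤ r i x z)
    (hcont : ∀ ε : ℝ, 0 < ε → ∃ η : ℝ, 0 < η ∧ ∀ i x (y y' : Mixed B), l1dist y y' ≤ η →
      r i x y' ≤ r i x y + ε)
    (n : ℕ) (a : ℕ → ℝ) (ha : ∀ i, 0 ≤ a i) :
    ∃ N, ∃ q ∈ stdSimplex ℝ (Fin N), ∀ y,
      ∑ k, q k * ∑ i ∈ Finset.range n, a i * r i (X k) y ≤ 1 := by
  classical
  set s := ∑ i ∈ Finset.range n, a i with hs
  have hs0 : 0 ≤ s := Finset.sum_nonneg fun i _ => ha i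
  -- With this accuracy the total error s / (s + 1) stays below 1, whatever the weights.
  obtain ⟨η, hη, hmod⟩ := hcont (s + 1)⁻¹ (by positivity)
  obtain ⟨N, hN⟩ := hc.exists_lt_of_compactSpace continuous_l1dist l1dist_self hη
  let f : Fin N → (B → ℝ) → ℝ := fun k y =>
    if h : y ∈ stdSimplex ℝ B then ∑ i ∈ Finset.range n, a i * r i (X k) ⟨y, h⟩ else 0
  have hf : ∀ k (y : Mixed B), f k y.1 = ∑ i ∈ Finset.range n, a i * r i (X k) y :=
    fun k y => dif_pos y.2
  have hfc : ∀ k, ConcaveOn ℝ (stdSimplex ℝ B) (f k) := by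
    refine fun k => ⟨convex_stdSimplex ℝ B, fun y hy y' hy' α β hα hβ hαβ => ?_⟩
    have hz := convex_stdSimplex ℝ B hy hy' hα hβ hαβ
    rw [hf k ⟨y, hy⟩, hf k ⟨y', hy'⟩, hf k ⟨_, hz⟩, smul_eq_mul, smul_eq_mul, Finset.mul_sum,
      Finset.mul_sum, ← Finset.sum_add_distrib]
    refine Finset.sum_le_sum fun i _ => ?_
    have := mul_le_mul_of_nonneg_left
      (hconc i (X k) ⟨y, hy⟩ ⟨y', hy'⟩ ⟨_, hz⟩ α β hα hβ hαβ rfl) (ha i)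
    linarith
  obtain ⟨q, hq, hle⟩ := exists_weights_of_concaveOn (convex_stdSimplex ℝ B)
    Set.Nonempty.of_subtype hfc (δ := 1) fun y hy => by
      obtain ⟨k, hkN, hk⟩ := hN ⟨y, hy⟩
      refine ⟨⟨k, hkN⟩, ?_⟩
      rw [hf ⟨k, hkN⟩ ⟨y, hy⟩]
      calc ∑ i ∈ Finset.range n, a i * r i (X k) ⟨y, hy⟩
          ≤ ∑ i ∈ Finset.range n, a i * (s + 1)⁻¹ := by
            refine Finset.sum_le_sum fun i _ => mul_le_mul_of_nonneg_left ?_ (ha i)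
            linarith [hmod i (X k) (c k) ⟨y, hy⟩ hk.le, hX i k]
        _ = s / (s + 1) := by rw [← Finset.sum_mul, ← hs, div_eq_mul_inv]
        _ ≤ 1 := (div_le_one (by positivity)).2 (by linarith)
  exact ⟨N, q, hq, fun y => by simpa only [hf] using hle y.1 y.2⟩

/-- A measurable discretization of the simplex along a dense sequence. -/
theorem exists_measurable_l1dist_le {c : ℕ → Mixed B} (hc : DenseRange c) {η : ℝ} (hη : 0 < η) :
    ∃ ρ : Mixed B → ℕ, Measurable ρ ∧ ∀ y, l1dist (c (ρ y)) y ≤ η := by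
  classical
  have hp : ∀ y, ∃ k, l1dist (c k) y ≤ η := fun y => by
    obtain ⟨N, hN⟩ := hc.exists_lt_of_compactSpace continuous_l1dist l1dist_self hη
    obtain ⟨k, -, hk⟩ := hN y
    exact ⟨k, hk.le⟩
  refine ⟨fun y => Nat.find (hp y), measurable_find hp fun k => ?_, fun y => Nat.find_spec (hp y)⟩
  exact (isClosed_le (continuous_l1dist.comp (continuous_const.prodMk continuous_id))
    continuous_const).measurableSet

/-- If the averages of sets bounded by `M` have small excess in finitely many directions which
are sufficiently dense in the unit ball, then they have small excess. -/
theorem excess_avgPayoff_le {M e : ℝ} (hM : ∀ x y, ∀ v ∈ m x y, ‖v‖ ≤ M)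
    (hne : C.Nonempty) (hclosed : IsClosed C) (hconvex : Convex ℝ C)
    (hCM : ∀ v ∈ C, ‖v‖ ≤ M) {p : ℕ → Reward d} {I : ℕ}
    (hpnet : ∀ u : Reward d, ‖u‖ ≤ 1 → ∃ i < I, ‖u - p i‖ * M ≤ e)
    {h : ℕ → Mixed A × Mixed B} {T : ℕ} (hT : 1 ≤ T)
    (hsum : ∀ i < I, ∑ t ∈ Finset.range T,
      (supportFun (m (h t).1 (h t).2) (p i) - supportFun C (p i)) ≤ 3 * e * T) :
    excess (avgPayoff m h T) C ≤ ENNReal.ofReal (5 * e) := by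
  have hT0 : (0 : ℝ) < T := by exact_mod_cast hT
  refine iSup₂_le fun v hv => ?_
  obtain ⟨w, hw, rfl⟩ := hv
  obtain ⟨g, hg, rfl⟩ := (Set.mem_finsetSum _ _ _).1 hw
  have hnorm : ‖(T : ℝ)⁻¹ • ∑ t ∈ Finset.range T, g t‖ ≤ M := by
    rw [norm_smul, norm_inv, Real.norm_natCast, inv_mul_le_iff₀ hT0]
    calc ‖∑ t ∈ Finset.range T, g t‖ ≤ ∑ _t ∈ Finset.range T, M :=
          norm_sum_le_of_le _ fun t ht => hM _ _ _ (hg ht)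
      _ = T * M := by simp
  refine infEDist_le_of_inner_le hne hclosed hconvex fun u hu => ?_
  obtain ⟨i, hi, hui⟩ := hpnet u hu
  have h1 : ⟪p i, (T : ℝ)⁻¹ • ∑ t ∈ Finset.range T, g t⟫ ≤ supportFun C (p i) + 3 * e := by
    rw [real_inner_smul_right, inner_sum, inv_mul_le_iff₀ hT0]
    have hle : ∑ t ∈ Finset.range T, ⟪p i, g t⟫ ≤
        ∑ t ∈ Finset.range T, supportFun (m (h t).1 (h t).2) (p i) :=
      Finset.sum_le_sum fun t ht => inner_le_supportFun (hM _ _) (hg ht)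
    have := hsum i hi
    rw [Finset.sum_sub_distrib] at this
    simp only [Finset.sum_const, Finset.card_range, nsmul_eq_mul] at this
    linarith
  have h2 : supportFun C (p i) ≤ supportFun C u + e := by
    refine (supportFun_le_add hCM hne (p' := u)).trans ?_
    rw [norm_sub_rev]
    gcongr
  have h3 : ⟪u - p i, (T : ℝ)⁻¹ • ∑ t ∈ Finset.range T, g t⟫ ≤ e :=
    (real_inner_le_norm _ _).trans (le_trans (by gcongr) hui)
  rw [inner_sub_left] at h3
  -- 5e = 3e from the sums, plus e for each of the two replacements of u by `p i`.
  linarith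

end Sufficiency

/-! ### Assembling the two implications -/

section MainTheorem

open MeasureTheory ProbabilityTheory Filter Topology
open scoped RealInnerProductSpace

variable {A B : Type*} [Fintype A] [Fintype B] {d : ℕ} {m : Mixed A → Mixed B → Set (Reward d)}
  {C : Set (Reward d)}

theorem exists_dense_unit_directions (d : ℕ) : ∃ p : ℕ → Reward d, (∀ i, ‖p i‖ ≤ 1) ∧
    ∀ η : ℝ, 0 < η → ∃ I, ∀ u : Reward d, ‖u‖ ≤ 1 → ∃ i < I, ‖u - p i‖ < η := by
  have hcomp : CompactSpace (Metric.closedBall (0 : Reward d) 1) :=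
    isCompact_iff_compactSpace.1 (isCompact_closedBall 0 1)
  have hne : Nonempty (Metric.closedBall (0 : Reward d) 1) := ⟨⟨0, by simp⟩⟩
  refine ⟨fun i => TopologicalSpace.denseSeq (Metric.closedBall (0 : Reward d) 1) i,
    fun i => mem_closedBall_zero_iff.1
      (TopologicalSpace.denseSeq (Metric.closedBall (0 : Reward d) 1) i).2,
    fun η hη => ?_⟩
  obtain ⟨I, hI⟩ := (TopologicalSpace.denseRange_denseSeq
    (Metric.closedBall (0 : Reward d) 1)).exists_lt_of_compactSpace continuous_dist dist_self hη
  refine ⟨I, fun u hu => ?_⟩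
  obtain ⟨i, hi, hd⟩ := hI ⟨u, by simpa using hu⟩
  refine ⟨i, hi, ?_⟩
  rwa [dist_comm, Subtype.dist_eq, dist_eq_norm] at hd

theorem sum_half_pow_le (T : ℕ) : ∑ t ∈ Finset.range T, (1 / 2 : ℝ) ^ t ≤ 2 :=
  (summable_geometric_two.sum_le_tsum _ fun _ _ => by positivity).trans tsum_geometric_two.le

/-- Sufficiency of the robust approachability condition, for nonempty payoffs and a bounded
target set. -/
theorem RAC.robustApproachable_of_nonempty [Nonempty A] [Nonempty B] (hrac : RAC m C)
    (hclosed : IsClosed C) (hconvex : Convex ℝ C) {M : ℝ}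
    (hM : ∀ x y, ∀ v ∈ m x y, ‖v‖ ≤ M) (hCM : ∀ v ∈ C, ‖v‖ ≤ M) (hne : ∀ x y, (m x y).Nonempty)
    (hm : ConvexSnd m) (hcont : UnifContSnd m) : RobustApproachable m C := by
  have hneB : Nonempty (Mixed B) := inferInstance
  set c : ℕ → Mixed B := TopologicalSpace.denseSeq (Mixed B) with hcdef
  have hc : DenseRange c := TopologicalSpace.denseRange_denseSeq _
  choose X hX using fun k => hrac (c k)
  have hCne : C.Nonempty := (hne (X 0) (c 0)).mono (hX 0)
  have hM0 : 0 ≤ M := by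
    obtain ⟨v, hv⟩ := hCne
    exact (norm_nonneg v).trans (hCM v hv)
  obtain ⟨p, hp1, hpnet⟩ := exists_dense_unit_directions d
  let r : ℕ → Mixed A → Mixed B → ℝ := fun i x y =>
    supportFun (m x y) (p i) - supportFun C (p i)
  have hR : ∀ i x y, |r i x y| ≤ 2 * M := by
    intro i x y
    have h1 := abs_le.1 (abs_supportFun_le (hM x y) (hne x y) (hp1 i))
    have h2 := abs_le.1 (abs_supportFun_le hCM hCne (hp1 i))
    exact abs_le.2 ⟨by simp only [r]; linarith, by simp only [r]; linarith⟩
  have hmod : ∀ ε η : ℝ, (∀ y y' : Mixed B, l1dist y y' ≤ η →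
      ∀ x : Mixed A, m x y' ⊆ m x y + Metric.closedBall (0 : Reward d) ε) →
      ∀ i x (y y' : Mixed B), l1dist y y' ≤ η → r i x y' ≤ r i x y + ε := by
    intro ε η h i x y y' hyy'
    have := supportFun_le_add_of_subset (hM x y) (hne x y') (hp1 i) (h y y' hyy' x)
    simp only [r]
    linarith
  -- Summable accuracies: rounding costs at most 2 over the whole play.
  choose η hη hsub using fun t : ℕ => hcont ((1 / 2 : ℝ) ^ t) (by positivity)
  choose ρ hρ hρc using fun t => exists_measurable_l1dist_le hc (hη t)
  have hsel := exists_weights_of_rac (r := r) hc (X := X)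
    (fun i k => sub_nonpos.2 (supportFun_le (hne _ _)
      fun v hv => inner_le_supportFun hCM (hX k hv)))
    (fun i x y y' z a b ha hb hab hz => by
      obtain rfl : b = 1 - a := by linarith
      have := le_supportFun_of_smul_add_smul_subset (p := p i) (hM x z) (hne x y) (hne x y')
        ha hb (hm x y y' z a ha (by linarith) hz)
      simp only [r]
      linarith)
    (fun ε hε => by
      obtain ⟨η, hη, h⟩ := hcont ε hε
      exact ⟨η, hη, hmod ε η h⟩)
  obtain ⟨σ, F, hFm, hF, hσ⟩ := exists_strategy_lintegral_potential_le hR X c ρ hρ hsel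
  refine ⟨σ, fun ε hε => ?_⟩
  set e : ℝ := ε / 5 with he
  have he0 : 0 < e := by positivity
  obtain ⟨I, hI⟩ := hpnet (e / (M + 1)) (by positivity)
  set δ : ℝ := (((I : ℝ) + 1)⁻¹ * e) ^ 2 with hδ
  have hδ0 : 0 < δ := by positivity
  obtain ⟨N₀, hN₀⟩ := exists_measure_exists_ge_le
    (b := 3 * (2 * M) ^ 2 + 2) hδ0 hε hFm
  -- 4M is twice the bound 2M on the r_i, for interpolation; the extra 2 pays for the rounding.
  obtain ⟨N₁, hN₁⟩ := exists_nat_ge ((4 * M + 2) / e)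
  set N : ℕ := max (max N₀ I) N₁ with hN
  have hNe : 4 * M + 2 ≤ e * N := by
    rw [div_le_iff₀ he0] at hN₁
    refine hN₁.trans ?_
    rw [mul_comm]
    gcongr
    exact le_max_right _ _
  refine ⟨N ^ 2, fun τ => ?_⟩
  obtain ⟨hae, hFint⟩ := hσ τ
  have hrange : MeasurableSet {h : ℕ → Mixed A × Mixed B | ∀ t, (h t).1 ∈ Set.range X} := by
    rw [Set.ofPred_forall]
    exact MeasurableSet.iInter fun t => (measurable_fst.comp (measurable_pi_apply t))
      (Set.countable_range X).measurableSet
  set bad : Set (ℕ → Mixed A × Mixed B) :=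
    {h | ∃ n : ℕ, N₀ ≤ n ∧ ENNReal.ofReal (δ * (n : ℝ) ^ 4) ≤ F (n ^ 2) h} with hbad
  have hbadm : MeasurableSet bad := by
    have : bad = ⋃ n, ⋃ (_ : N₀ ≤ n),
        {h | ENNReal.ofReal (δ * (n : ℝ) ^ 4) ≤ F (n ^ 2) h} := by
      ext h; simp [hbad]
    rw [this]
    exact MeasurableSet.iUnion fun n => MeasurableSet.iUnion fun _ =>
      measurableSet_le measurable_const (hFm _)
  refine ⟨{h | ∀ t, (h t).1 ∈ Set.range X} ∩ badᶜ, hrange.inter hbadm.compl, ?_, ?_⟩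
  · rintro h ⟨hx, hgood⟩ T hT1 hT
    have hTe : 2 ≤ e * T := by
      have h1 : (N : ℝ) ≤ T := by
        have : N ≤ N ^ 2 := Nat.le_self_pow two_ne_zero N
        exact_mod_cast this.trans hT
      have : e * N ≤ e * T := by gcongr
      linarith
    have h5 : 5 * e = ε := by rw [he]; ring
    rw [← h5]
    refine excess_avgPayoff_le (p := p) (I := I) hM hCne hclosed hconvex hCM
      (fun u hu => ?_) hT1 fun i hi => ?_
    · obtain ⟨i, hi, hui⟩ := hI u hu
      refine ⟨i, hi, ?_⟩
      rw [lt_div_iff₀ (by positivity)] at hui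
      nlinarith [norm_nonneg (u - p i)]
    · have hpot : ∀ n : ℕ, N ≤ n → ∑ i ∈ Finset.range (n ^ 2), ((i : ℝ) + 1)⁻¹ ^ 2 *
          max 0 (∑ t ∈ Finset.range (n ^ 2), r i (h t).1 (c (ρ t (h t).2))) ^ 2 ≤
          δ * (n : ℝ) ^ 4 := by
        intro n hn
        by_contra! hlt
        refine hgood ⟨n, (le_max_left N₀ I).trans ((le_max_left _ _).trans hn), ?_⟩
        rw [hF h hx]
        exact ENNReal.ofReal_le_ofReal hlt.le
      have h1 := sum_range_le_of_sum_sq_le (r := fun i t => r i (h t).1 (c (ρ t (h t).2)))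
        (R := 2 * M) he0 (fun i t => (abs_le.1 (hR _ _ _)).2)
        ((le_max_right N₀ I).trans (le_max_left _ _)) (by linarith) hpot hT hi
      calc ∑ t ∈ Finset.range T, r i (h t).1 (h t).2
          ≤ ∑ t ∈ Finset.range T, (r i (h t).1 (c (ρ t (h t).2)) + (1 / 2 : ℝ) ^ t) :=
            Finset.sum_le_sum fun t _ => hmod _ _ (hsub t) i _ _ _ (hρc t _)
        _ ≤ 2 * e * T + 2 := by
            rw [Finset.sum_add_distrib]
            exact add_le_add h1 (sum_half_pow_le T)
        _ ≤ 3 * e * T := by linarith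
  · have hinter : playLaw σ τ ({h | ∀ t, (h t).1 ∈ Set.range X} ∩ badᶜ) =
        playLaw σ τ badᶜ := by
      refine measure_congr ?_
      filter_upwards [hae] with h hh
      exact propext (and_iff_right hh)
    rw [hinter, prob_compl_eq_one_sub hbadm, ENNReal.ofReal_sub _ hε.le, ENNReal.ofReal_one]
    exact tsub_le_tsub_left (hN₀ _ hFint) _

theorem RAC.robustApproachable [Nonempty A] [Nonempty B] (hrac : RAC m C)
    (hclosed : IsClosed C) (hconvex : Convex ℝ C) (hbdd : BoundedPayoff m)
    (hm : ConvexSnd m) (hcont : UnifContSnd m) : RobustApproachable m C := by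
  by_cases hne : ∀ x y, (m x y).Nonempty
  · obtain ⟨M, hM⟩ := hbdd
    obtain ⟨σ, hσ⟩ := RAC.robustApproachable_of_nonempty
      -- Cutting C by the ball keeps (RAC) and makes its support function finite; approaching the
      -- smaller set is enough.
      (C := C ∩ Metric.closedBall 0 M) (m := m)
      (fun y => by
        obtain ⟨x, hx⟩ := hrac y
        exact ⟨x, fun v hv => ⟨hx hv, by simpa using hM x y v hv⟩⟩)
      (hclosed.inter Metric.isClosed_closedBall) (hconvex.inter (convex_closedBall 0 M))
      hM (fun v hv => by simpa using hv.2) hne hm hcont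
    refine ⟨σ, fun ε hε => ?_⟩
    obtain ⟨T₀, hT₀⟩ := hσ ε hε
    refine ⟨T₀, fun τ => ?_⟩
    obtain ⟨E, hE, hsub, hP⟩ := hT₀ τ
    exact ⟨E, hE, fun h hh T hT1 hT => (iSup₂_mono fun v _ =>
      Metric.infEDist_anti Set.inter_subset_left).trans (hsub hh T hT1 hT), hP⟩
  · push Not at hne
    obtain ⟨x, y, hxy⟩ := hne
    -- Repeating this x makes every Minkowski average empty, so the excess is zero.
    exact robustApproachable_of_eq_empty (hcont.eq_empty hxy)

end MainTheorem

theorem mainTheorem6 {A B : Type*} [Fintype A] [Fintype B] [Nonempty A] [Nonempty B] {d : ℕ}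
    (m : Mixed A → Mixed B → Set (Reward d)) (C : Set (Reward d))
    (hclosed : IsClosed C) (hconvex : Convex ℝ C) :
    (BoundedPayoff m → ConvexSnd m → UnifContSnd m → RAC m C → RobustApproachable m C) ∧
    (ConcaveFst m → UnifContFst m → RobustApproachable m C → RAC m C) :=
  ⟨fun hbdd hm hcont hrac => hrac.robustApproachable hclosed hconvex hbdd hm hcont,
    fun hm hcont happ => happ.rac hclosed hm hcont⟩
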